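/- Let $\mathcal A$ be a closed bounded convex subset of a (Hausdorff) locally convex space $E$ such that $\mathcal A$ is a complete separable metric space in the following sense: there is a countable family of continuous seminorms on $E$ that induces on $\mathcal A$ the topology of $E$, and $\mathcal A$ is separable, and complete in the metric generated by this family. Let $M(\mathcal A)$ be the set of Borel probability measures on $\mathcal A$ with the topology of weak convergence. The barycenter $\mathbf b(\mu)\in\mathcal A$ of $\mu\in M(\mathcal A)$ is the Pettis integral $\int_{\mathcal A}x\,\mu(dx)$, and $M_x(\mathcal A)=\{\mu\in M(\mathcal A):\mathbf b(\mu)=x\}$. The set $\mathcal A$ is called $\mu$-compact if $\mathbf b^{-1}(\mathcal K)$ is compact in $M(\mathcal A)$ for every compact $\mathcal K\subseteq\mathcal A$, and pointwise $\mu$-compact if $M_x(\mathcal A)$ is compact for every $x\in\mathcal A$. For a bounded function $f$ on $\mathcal A$, its convex hull $\mathrm{co}f$ is the largest convex function on $\mathcal A$ not exceeding $f$, and its convex closure $\overline{\mathrm{co}}f$ is the largest convex lower semicontinuous function on $\mathcal A$ not exceeding $f$. Suppose that $\mathcal A$ is pointwise $\mu$-compact but not $\mu$-compact. Then there exists a continuous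 bounded function $f:\mathcal A\to\mathbb R$ whose convex hull $\mathrm{co}f$ is not lower semicontinuous on $\mathcal A$, and for which the representation $$\overline{\mathrm{co}}f(x)=\inf_{\mu\in M_x(\mathcal A)}\int_{\mathcal A}f(y)\,\mu(dy)\qquad\text{for all }x\in\mathcal A$$ does not hold. -/

import Mathlib

open MeasureTheory Filter Topology Set

namespace MuCompact

section Sets

variable {E : Type*} [AddCommGroup E] [Module ℝ E] [TopologicalSpace E]

/-- The uniform structure on `E` generated by a sequence of seminorms, that is, the one of the
metric `∑ 2⁻ⁿ min 1 (p n (x - y))`. -/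
abbrev seminormUniformity (p : ℕ → Seminorm ℝ E) : UniformSpace E :=
  ⨅ n, (p n).toSeminormedAddCommGroup.toUniformSpace

/-- The standing assumptions on a set `A` in a locally convex space: it is closed and bounded, and
its closed convex hull is a complete separable metric space, meaning that its topology is defined by
countably many continuous seminorms of the locally convex space, in whose metric it is
separable and complete. -/
structure IsAdmissible (A : Set E) : Prop where
  isClosed : IsClosed A
  isBounded : Bornology.IsVonNBounded ℝ A
  isSeparable : TopologicalSpace.IsSeparable (closure (convexHull ℝ A))
  exists_seminorms : ∃ p : ℕ → Seminorm ℝ E, (∀ n, Continuous (p n)) ∧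
    TopologicalSpace.induced ((↑) : closure (convexHull ℝ A) → E)
        (seminormUniformity p).toTopologicalSpace =
      (instTopologicalSpaceSubtype : TopologicalSpace (closure (convexHull ℝ A))) ∧
    @IsComplete E (seminormUniformity p) (closure (convexHull ℝ A))

variable [MeasurableSpace E]

/-- `x` is the barycenter (Pettis integral `∫ y μ(dy)`) of the Borel probability measure `μ` on
`A`. -/
def IsBarycenter {A : Set E} (μ : ProbabilityMeasure A) (x : E) : Prop :=
  ∀ φ : E →L[ℝ] ℝ, Integrable (fun y : A => φ y) (μ : Measure A) ∧
    ∫ y : A, φ y ∂(μ : Measure A) = φ x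

/-- The set `M_x(A)` of Borel probability measures on `A` with barycenter `x`. -/
def measuresWithBarycenter (A : Set E) (x : E) : Set (ProbabilityMeasure A) :=
  {μ | IsBarycenter μ x}

variable [BorelSpace E]

/-- `A` is `μ`-compact: the preimage of every compact subset of the closed convex hull of `A` under
the barycenter map is compact for the topology of weak convergence. -/
def IsMuCompact (A : Set E) : Prop :=
  ∀ K : Set E, K ⊆ closure (convexHull ℝ A) → IsCompact K →
    IsCompact {μ : ProbabilityMeasure A | ∃ x ∈ K, IsBarycenter μ x}

/-- `A` is pointwise `μ`-compact: for every `x` in the closed convex hull of `A` the set `M_x(A)` is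
compact for the topology of weak convergence. -/
def IsPointwiseMuCompact (A : Set E) : Prop :=
  ∀ x ∈ closure (convexHull ℝ A), IsCompact (measuresWithBarycenter A x)

end Sets

section Functions

variable {E : Type*} [AddCommGroup E] [Module ℝ E]

/-- The convex hull on `A` of a function `f` that is bounded below on `A`: the largest convex
function on `A` not exceeding `f`. Only the values on `A` are meaningful. -/
noncomputable def coFun (A : Set E) (f : E → ℝ) (x : E) : ℝ :=
  sSup {r | ∃ g : E → ℝ, ConvexOn ℝ A g ∧ (∀ y ∈ A, g y ≤ f y) ∧ r = g x}

/-- The convex closure on `A` of a function `f` that is bounded below on `A`: the largest lower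
semicontinuous convex function on `A` not exceeding `f`. Only the values on `A` are meaningful. -/
noncomputable def coClosureFun [TopologicalSpace E] (A : Set E) (f : E → ℝ) (x : E) : ℝ :=
  sSup {r | ∃ g : E → ℝ, ConvexOn ℝ A g ∧ LowerSemicontinuousOn g A ∧
    (∀ y ∈ A, g y ≤ f y) ∧ r = g x}

theorem le_coFun {A : Set E} {f g : E → ℝ} (hg : ConvexOn ℝ A g) (hgf : ∀ y ∈ A, g y ≤ f y)
    {x : E} (hx : x ∈ A) : g x ≤ coFun A f x :=
  le_csSup ⟨f x, by rintro _ ⟨g', -, h, rfl⟩; exact h x hx⟩ ⟨g, hg, hgf, rfl⟩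

/-- For `f` bounded below on a convex set `A`, `coFun A f` does not exceed `f` on `A`. -/
theorem coFun_le {A : Set E} (hA : Convex ℝ A) {f : E → ℝ} {c : ℝ} (hc : ∀ y ∈ A, c ≤ f y)
    {x : E} (hx : x ∈ A) : coFun A f x ≤ f x :=
  csSup_le ⟨c, fun _ => c, convexOn_const c hA, hc, rfl⟩
    (by rintro _ ⟨g', -, h, rfl⟩; exact h x hx)

/-- For `f` bounded below on a convex set `A`, `coFun A f` is convex on `A`. -/
theorem convexOn_coFun {A : Set E} (hA : Convex ℝ A) {f : E → ℝ} {c : ℝ}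
    (hc : ∀ y ∈ A, c ≤ f y) : ConvexOn ℝ A (coFun A f) := by
  refine ⟨hA, fun x hx y hy a b ha hb hab => ?_⟩
  refine csSup_le ⟨c, fun _ => c, convexOn_const c hA, hc, rfl⟩ ?_
  rintro _ ⟨g, hg, h, rfl⟩
  refine (hg.2 hx hy ha hb hab).trans ?_
  have h1 := le_coFun hg h hx
  have h2 := le_coFun hg h hy
  simp only [smul_eq_mul]
  gcongr

variable [TopologicalSpace E]

theorem le_coClosureFun {A : Set E} {f g : E → ℝ} (hg : ConvexOn ℝ A g)
    (hl : LowerSemicontinuousOn g A) (hgf : ∀ y ∈ A, g y ≤ f y)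
    {x : E} (hx : x ∈ A) : g x ≤ coClosureFun A f x :=
  le_csSup ⟨f x, by rintro _ ⟨g', -, -, h, rfl⟩; exact h x hx⟩ ⟨g, hg, hl, hgf, rfl⟩

/-- For `f` bounded below on a convex set `A`, `coClosureFun A f` does not exceed `f` on `A`. -/
theorem coClosureFun_le {A : Set E} (hA : Convex ℝ A) {f : E → ℝ} {c : ℝ}
    (hc : ∀ y ∈ A, c ≤ f y) {x : E} (hx : x ∈ A) : coClosureFun A f x ≤ f x :=
  csSup_le ⟨c, fun _ => c, convexOn_const c hA, lowerSemicontinuousOn_const, hc, rfl⟩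
    (by rintro _ ⟨g', -, -, h, rfl⟩; exact h x hx)

/-- For `f` bounded below on a convex set `A`, `coClosureFun A f` is convex on `A`. -/
theorem convexOn_coClosureFun {A : Set E} (hA : Convex ℝ A) {f : E → ℝ} {c : ℝ}
    (hc : ∀ y ∈ A, c ≤ f y) : ConvexOn ℝ A (coClosureFun A f) := by
  refine ⟨hA, fun x hx y hy a b ha hb hab => ?_⟩
  refine csSup_le ⟨c, fun _ => c, convexOn_const c hA, lowerSemicontinuousOn_const, hc, rfl⟩ ?_
  rintro _ ⟨g, hg, hl, h, rfl⟩
  refine (hg.2 hx hy ha hb hab).trans ?_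
  have h1 := le_coClosureFun hg hl h hx
  have h2 := le_coClosureFun hg hl h hy
  simp only [smul_eq_mul]
  gcongr

/-- For `f` bounded below on a convex set `A`, `coClosureFun A f` is lower semicontinuous on `A`. -/
theorem lowerSemicontinuousOn_coClosureFun {A : Set E} (hA : Convex ℝ A) {f : E → ℝ} {c : ℝ}
    (hc : ∀ y ∈ A, c ≤ f y) : LowerSemicontinuousOn (coClosureFun A f) A := by
  intro x hx r hr
  obtain ⟨_, ⟨g, hg, hl, h, rfl⟩, hrg⟩ := exists_lt_of_lt_csSup
    (by exact ⟨c, fun _ => c, convexOn_const c hA, lowerSemicontinuousOn_const, hc, rfl⟩) hr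
  filter_upwards [hl x hx r hrg, self_mem_nhdsWithin] with y hy hyA
  exact lt_of_lt_of_le hy (le_coClosureFun hg hl h hyA)

end Functions

end MuCompact

namespace MuCompact

/-! ### Complete metrizability of `A`. -/

section Polish

/-! Since `A` is Polish, Prokhorov's theorem turns the failure of `μ`-compactness into a failure of
tightness: there are measures `μ n` with barycenters in a compact `K` that eventually leave mass at
least `ε` outside the `η`-thickening of any given compact set (`exists_seq_measure_thickening_le`).
Their barycenters cluster at some `x₀ ∈ K`. The measures with barycenter `x₀` are tight, so all of
them give mass at least `1 - ε / 2` to one compact `T`. Take for `f` the thickened indicator of `T`: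
its integral is at least `1 - ε / 2` for every measure with barycenter `x₀`, but eventually at most
`1 - ε` for `μ n`.

A convex minorant of `f` that is lower semicontinuous at `x₀` and exceeds `1 - 3 * ε / 4` there is
incompatible with this jump, by `eventually_lt_integral_of_lowerSemicontinuousWithinAt`. Both
conclusions follow, because `infBarycenter` at `x₀` bounds `coFun` from below and would equal
`coClosureFun` under the representation. -/

theorem polishSpace_of_isComplete {X : Type*} [UniformSpace X] [(uniformity X).IsCountablyGenerated]
    {S : Set X} [T0Space S] (hc : IsComplete S) (hs : TopologicalSpace.IsSeparable S) :
    PolishSpace S := by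
  have : CompleteSpace S := completeSpace_coe_iff_isComplete.2 hc
  have : (uniformity S).IsCountablyGenerated := by
    rw [uniformity_comap ((↑) : S → X)]; infer_instance
  have : TopologicalSpace.SeparableSpace S := hs.separableSpace
  infer_instance

variable {E : Type*} [AddCommGroup E] [Module ℝ E] [TopologicalSpace E]

/-- Separability of `A` can thus be carried from `E` to the seminorm topology. -/
theorem le_toTopologicalSpace_seminormUniformity [IsTopologicalAddGroup E]
    {p : ℕ → Seminorm ℝ E} (hp : ∀ n, Continuous (p n)) :
    (inferInstance : TopologicalSpace E) ≤ (seminormUniformity p).toTopologicalSpace := by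
  rw [UniformSpace.toTopologicalSpace_iInf]
  refine le_iInf fun n => le_of_nhds_le_nhds fun x => ?_
  let _ := (p n).toSeminormedAddCommGroup
  refine (Metric.nhds_basis_ball.ge_iff).2 fun ε hε => ?_
  have h : Continuous fun y => p n (y - x) := (hp n).comp (continuous_id.sub continuous_const)
  have h2 := (h.tendsto x).eventually_lt_const (u := ε) (by simpa using hε)
  filter_upwards [h2] with y hy
  rw [Metric.mem_ball, dist_eq_norm]
  exact hy

instance isCountablyGenerated_seminormUniformity (p : ℕ → Seminorm ℝ E) :
    (@uniformity E (seminormUniformity p)).IsCountablyGenerated := by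
  rw [iInf_uniformity]
  have h (n : ℕ) : (@uniformity E
      (p n).toSeminormedAddCommGroup.toUniformSpace).IsCountablyGenerated :=
    let _ := (p n).toSeminormedAddCommGroup
    inferInstance
  exact Filter.iInf.isCountablyGenerated _

theorem IsAdmissible.polishSpace [IsTopologicalAddGroup E] [T2Space E] {A : Set E}
    (hA : IsAdmissible A) (hconv : Convex ℝ A) : PolishSpace A := by
  obtain ⟨hs, p, hp, hi, hc⟩ := And.intro hA.isSeparable hA.exists_seminorms
  have hcl : closure (convexHull ℝ A) = A := by
    rw [hconv.convexHull_eq]; exact hA.isClosed.closure_eq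
  rw [hcl] at hs hi hc
  have hT : T0Space A := inferInstance
  obtain ⟨c, hcc, hAc⟩ := hs
  have hle := le_toTopologicalSpace_seminormUniformity hp
  have hs' : @TopologicalSpace.IsSeparable E (seminormUniformity p).toTopologicalSpace A :=
    by
    refine ⟨c, hcc, fun x hx => ?_⟩
    rw [@mem_closure_iff E (seminormUniformity p).toTopologicalSpace]
    exact fun o ho hxo => mem_closure_iff.1 (hAc hx) o (hle o ho) hxo
  rw [← hi] at hT ⊢
  exact @polishSpace_of_isComplete E (seminormUniformity p) _ A hT hc hs'

end Polish

/-! ### Tightness and escaping mass. -/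

section Tight

variable {X : Type*} [MetricSpace X] [CompleteSpace X] [MeasurableSpace X]

/-- A family of measures that concentrates, up to every `ε`, in finitely many balls of every given
radius is tight. -/
theorem isTightMeasureSet_of_forall_closedBall {S : Set (Measure X)} (D : ℕ → X)
    (h : ∀ ε : ENNReal, 0 < ε → ∀ η : ℝ, 0 < η → ∃ m, ∀ μ ∈ S,
      μ (⋃ j ∈ Set.Iic m, Metric.closedBall (D j) η)ᶜ ≤ ε) : IsTightMeasureSet S := by
  rw [isTightMeasureSet_iff_exists_isCompact_measure_compl_le]
  intro ε hε
  -- The radius `1 / (n + 1)` is allowed to lose mass `u n`; the intersection over all radii is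
  -- closed and totally bounded.
  obtain ⟨u, hu, hus⟩ := ENNReal.exists_pos_sum_of_countable' hε.ne' ℕ
  choose m hm using fun n : ℕ => h (u n) (hu n) (1 / ((n : ℝ) + 1)) (by positivity)
  refine ⟨⋂ n : ℕ, ⋃ j ∈ Set.Iic (m n), Metric.closedBall (D j) (1 / ((n : ℝ) + 1)), ?_, ?_⟩
  · refine TotallyBounded.isCompact_of_isClosed ?_ (isClosed_iInter fun n =>
      (Set.finite_Iic _).isClosed_biUnion fun _ _ => Metric.isClosed_closedBall)
    refine Metric.totallyBounded_iff.2 fun δ hδ => ?_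
    obtain ⟨n, hn⟩ := exists_nat_one_div_lt hδ
    refine ⟨D '' Set.Iic (m n), (Set.finite_Iic _).image _, ?_⟩
    rw [biUnion_image]
    exact (iInter_subset _ n).trans
      (biUnion_mono subset_rfl fun _ _ => Metric.closedBall_subset_ball hn)
  · intro μ hμ
    rw [compl_iInter]
    exact (measure_iUnion_le _).trans ((ENNReal.tsum_le_tsum fun n => hm n μ hμ).trans hus.le)

/-- A family of probability measures that is not tight contains a sequence whose mass escapes
from some neighbourhood of every compact set. -/
theorem exists_seq_measure_thickening_le [BorelSpace X] {S : Set (ProbabilityMeasure X)}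
    [TopologicalSpace.SeparableSpace X]
    (hS : ¬ IsTightMeasureSet {((μ : ProbabilityMeasure X) : Measure X) | μ ∈ S}) :
    ∃ ε : ℝ, 0 < ε ∧ ∃ η : ℝ, 0 < η ∧ ∃ μ : ℕ → ProbabilityMeasure X, (∀ n, μ n ∈ S) ∧
      ∀ C : Set X, IsCompact C → ∀ᶠ n in atTop,
        (μ n : Measure X).real (Metric.thickening η C) ≤ 1 - ε := by
  have hne : Nonempty X := by
    by_contra hX
    rw [not_nonempty_iff] at hX
    exact hS (IsTightMeasureSet.of_compactSpace)
  have hD := TopologicalSpace.denseRange_denseSeq X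
  have h := mt (isTightMeasureSet_of_forall_closedBall (TopologicalSpace.denseSeq X)) hS
  push Not at h
  obtain ⟨ε, hε, η, hη, h⟩ := h
  have h' : ∀ n, ∃ μ ∈ S, ε < (μ : Measure X)
      (⋃ j ∈ Set.Iic n, Metric.closedBall (TopologicalSpace.denseSeq X j) η)ᶜ := by
    intro n
    obtain ⟨_, ⟨μ, hμ, rfl⟩, hlt⟩ := h n
    exact ⟨μ, hμ, hlt⟩
  choose μ hμS hμ using h'
  have hεt : ε ≠ ⊤ := (hμ 0).ne_top
  -- Half the radius is spent on covering `C` by balls around the dense sequence, the other half on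
  -- thickening it.
  refine ⟨ε.toReal, ENNReal.toReal_pos hε.ne' hεt, η / 2, by positivity, μ, hμS, fun C hC => ?_⟩
  obtain ⟨m, hm⟩ := hC.elim_directed_cover
    (fun m : ℕ => ⋃ j ∈ Set.Iic m, Metric.ball (TopologicalSpace.denseSeq X j) (η / 2))
    (fun m => isOpen_biUnion fun _ _ => Metric.isOpen_ball)
    (fun x _ => by
      obtain ⟨j, hj⟩ := hD.exists_dist_lt x (half_pos hη)
      exact mem_iUnion.2 ⟨j, mem_biUnion (Set.mem_Iic.2 le_rfl) hj⟩)
    (Monotone.directed_le fun a b hab => biUnion_mono (Set.Iic_subset_Iic.2 hab)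
      fun _ _ => subset_rfl)
  filter_upwards [eventually_ge_atTop m] with n hn
  have hsub : (⋃ j ∈ Set.Iic n, Metric.closedBall (TopologicalSpace.denseSeq X j) η)ᶜ ⊆
      (Metric.thickening (η / 2) C)ᶜ := by
    refine compl_subset_compl.2 fun x hx => ?_
    obtain ⟨y, hy, hxy⟩ := Metric.mem_thickening_iff.1 hx
    obtain ⟨j, hj, hyj⟩ := mem_iUnion₂.1 (hm hy)
    refine mem_biUnion (show j ∈ Set.Iic n from le_trans hj hn) ?_
    rw [Metric.mem_closedBall]
    rw [Metric.mem_ball] at hyj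
    linarith [dist_triangle x y (TopologicalSpace.denseSeq X j)]
  have h1 : ε.toReal ≤ (μ n : Measure X).real (Metric.thickening (η / 2) C)ᶜ :=
    ENNReal.toReal_mono (measure_ne_top _ _) ((hμ n).le.trans (measure_mono hsub))
  rw [probReal_compl_eq_one_sub Metric.isOpen_thickening.measurableSet] at h1
  linarith

end Tight

/-! ### Barycenters and the lower envelope over representing measures. -/

section Barycenter

theorem exists_abs_le_of_isVonNBounded {E : Type*} [AddCommGroup E] [Module ℝ E]
    [TopologicalSpace E] {A : Set E} (hA : Bornology.IsVonNBounded ℝ A)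
    (φ : E →L[ℝ] ℝ) :
    ∃ C : ℝ, ∀ y : A, |φ y| ≤ C := by
  have h := (NormedSpace.isVonNBounded_iff ℝ).1 (hA.image φ)
  obtain ⟨C, hC⟩ := h.exists_norm_le
  exact ⟨C, fun y => hC _ (mem_image_of_mem _ y.2)⟩

theorem integrable_of_continuousOn {E : Type*} [TopologicalSpace E] [MeasurableSpace E]
    [BorelSpace E] {A : Set E} {f : E → ℝ} (hf : ContinuousOn f A)
    {C : ℝ} (hC : ∀ y ∈ A, |f y| ≤ C) (μ : Measure A) [IsFiniteMeasure μ] :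
    Integrable (fun y : A => f y) μ :=
  Integrable.of_bound (continuousOn_iff_continuous_domRestrict.1 hf).aestronglyMeasurable C
    (Eventually.of_forall fun y => hC y y.2)

variable {E : Type*} [AddCommGroup E] [Module ℝ E] [TopologicalSpace E] [MeasurableSpace E]
  {A : Set E}

/-- The measures whose barycenter lies in a compact set form a closed set. -/
theorem isClosed_setOf_isBarycenter [BorelSpace E] (hA : Bornology.IsVonNBounded ℝ A) {K : Set E}
    (hK : IsCompact K) : IsClosed {μ : ProbabilityMeasure A | ∃ x ∈ K, IsBarycenter μ x} := by
  rw [isClosed_iff_ultrafilter]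
  intro μ u hu hmem
  choose! b hbK hb using fun (ν : ProbabilityMeasure A) (h : ∃ x ∈ K, IsBarycenter ν x) => h
  obtain ⟨x, hxK, hx⟩ := isCompact_iff_ultrafilter_le_nhds.1 hK (u.map b)
    (show Tendsto b u (𝓟 K) from tendsto_principal.2 (mem_of_superset hmem hbK))
  refine ⟨x, hxK, fun φ => ?_⟩
  obtain ⟨C, hC⟩ := exists_abs_le_of_isVonNBounded hA φ
  have hint (ν : ProbabilityMeasure A) : Integrable (fun y : A => φ y) (ν : Measure A) :=
    integrable_of_continuousOn φ.continuous.continuousOn (fun y hy => hC ⟨y, hy⟩) _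
  refine ⟨hint μ, ?_⟩
  have h1 := ProbabilityMeasure.tendsto_iff_forall_integral_tendsto.1
    (show Tendsto (fun ν => ν) (u : Filter (ProbabilityMeasure A)) (𝓝 μ) from hu)
    (BoundedContinuousFunction.ofNormedAddCommGroup (fun y : A => φ y) (by fun_prop) C hC)
  have h2 : Tendsto (fun ν => φ (b ν)) (u : Filter (ProbabilityMeasure A)) (𝓝 (φ x)) :=
    (φ.continuous.tendsto x).comp hx
  refine tendsto_nhds_unique h1 (h2.congr' ?_)
  filter_upwards [hmem] with ν hν
  exact ((hb ν hν φ).2).symm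

/-- If `x` is the barycenter of `μ`, then `(x, ∫ f dμ)` lies in the closed convex hull of the graph
of `f`. -/
theorem IsBarycenter.mem_closure_convexHull_graph [IsTopologicalAddGroup E] [ContinuousSMul ℝ E]
    [LocallyConvexSpace ℝ E] {f : E → ℝ} {μ : ProbabilityMeasure A} {x : E} (hx : IsBarycenter μ x)
    (hf : Integrable (fun y : A => f y) (μ : Measure A)) :
    (x, ∫ y : A, f y ∂(μ : Measure A)) ∈ closure (convexHull ℝ ((fun y => (y, f y)) '' A)) := by
  by_contra hn
  -- A separating functional is affine in `(y, f y)`, so integrating its bound on the graph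
  -- contradicts its value at the barycenter.
  obtain ⟨ψ, c, h1, h2⟩ := geometric_hahn_banach_closed_point
    (convex_convexHull ℝ _).closure isClosed_closure hn
  set φ : E →L[ℝ] ℝ := ψ.comp (ContinuousLinearMap.inl ℝ E ℝ) with hφ
  have hψ (y : E) (t : ℝ) : ψ (y, t) = φ y + ψ (0, 1) * t := by
    have : (y, t) = ContinuousLinearMap.inl ℝ E ℝ y + t • ((0, 1) : E × ℝ) := by
      simp [ContinuousLinearMap.inl_apply]
    rw [this, map_add, map_smul, smul_eq_mul, mul_comm]; rfl
  rw [hψ, ← (hx φ).2, ← integral_const_mul, ← integral_add (hx φ).1 (hf.const_mul _)] at h2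
  have h3 : ∫ y : A, (φ y + ψ (0, 1) * f y) ∂(μ : Measure A) ≤ ∫ _ : A, c ∂(μ : Measure A) := by
    refine integral_mono ((hx φ).1.add (hf.const_mul _)) (integrable_const c) fun y => ?_
    have := h1 _ (subset_closure (subset_convexHull ℝ _ (mem_image_of_mem _ y.2)))
    rw [hψ] at this
    exact this.le
  rw [integral_const, probReal_univ, one_smul] at h3
  exact h2.not_ge h3

theorem isBarycenter_dirac [BorelSpace E] {x : E} (hx : x ∈ A) :
    IsBarycenter (⟨Measure.dirac (⟨x, hx⟩ : A), inferInstance⟩ : ProbabilityMeasure A) x := by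
  intro φ
  have h : StronglyMeasurable fun y : A => φ y :=
    (show Continuous fun y : A => φ y by fun_prop).stronglyMeasurable
  exact ⟨integrable_dirac' h (by simp), integral_dirac' _ _ h⟩

/-- Mixtures of measures have the corresponding convex combinations as barycenters. -/
theorem IsBarycenter.exists_mixture {μ ν : ProbabilityMeasure A} {x y : E} (hx : IsBarycenter μ x)
    (hy : IsBarycenter ν y) {a b : ℝ} (ha : 0 ≤ a) (hb : 0 ≤ b) (hab : a + b = 1) :
    ∃ ρ : ProbabilityMeasure A, IsBarycenter ρ (a • x + b • y) ∧ ∀ g : A → ℝ,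
      Integrable g (μ : Measure A) → Integrable g (ν : Measure A) →
      ∫ z, g z ∂(ρ : Measure A) =
        a * ∫ z, g z ∂(μ : Measure A) + b * ∫ z, g z ∂(ν : Measure A) := by
  set m : Measure A := ENNReal.ofReal a • (μ : Measure A) + ENNReal.ofReal b • (ν : Measure A)
  have hm : IsProbabilityMeasure m := ⟨by
    simp only [m, Measure.add_apply, Measure.smul_apply, measure_univ, smul_eq_mul, mul_one]
    rw [← ENNReal.ofReal_add ha hb, hab, ENNReal.ofReal_one]⟩
  have hint (g : A → ℝ) (h1 : Integrable g (μ : Measure A)) (h2 : Integrable g (ν : Measure A)) :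
      Integrable g m ∧ ∫ z, g z ∂m =
        a * ∫ z, g z ∂(μ : Measure A) + b * ∫ z, g z ∂(ν : Measure A) := by
    have h1' := h1.smul_measure (c := ENNReal.ofReal a) ENNReal.ofReal_ne_top
    have h2' := h2.smul_measure (c := ENNReal.ofReal b) ENNReal.ofReal_ne_top
    refine ⟨h1'.add_measure h2', ?_⟩
    rw [integral_add_measure h1' h2', integral_smul_measure, integral_smul_measure,
      ENNReal.toReal_ofReal ha, ENNReal.toReal_ofReal hb, smul_eq_mul, smul_eq_mul]
  refine ⟨⟨m, hm⟩, fun φ => ?_, fun g h1 h2 => (hint g h1 h2).2⟩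
  obtain ⟨h1, h2⟩ := hint (fun z => φ z) (hx φ).1 (hy φ).1
  refine ⟨h1, h2.trans ?_⟩
  rw [(hx φ).2, (hy φ).2]
  simp

/-- The infimum of `∫ f dμ` over the probability measures `μ` with barycenter `x`. -/
noncomputable def infBarycenter (A : Set E) (f : E → ℝ) (x : E) : ℝ :=
  ⨅ μ : measuresWithBarycenter A x, ∫ y : A, f y ∂(μ.1 : Measure A)

theorem infBarycenter_le {f : E → ℝ} {C : ℝ} (hC : ∀ y ∈ A, |f y| ≤ C) {x : E}
    {μ : ProbabilityMeasure A} (hμ : IsBarycenter μ x) :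
    infBarycenter A f x ≤ ∫ y : A, f y ∂(μ : Measure A) := by
  refine ciInf_le (f := fun μ : measuresWithBarycenter A x => ∫ y : A, f y ∂(μ.1 : Measure A))
    ⟨-C, ?_⟩ ⟨μ, hμ⟩
  rintro _ ⟨ν, rfl⟩
  have h := norm_integral_le_of_norm_le_const (μ := (ν.1 : Measure A)) (f := fun y : A => f y)
    (C := C) (Eventually.of_forall fun y => hC y y.2)
  rw [probReal_univ, mul_one, Real.norm_eq_abs] at h
  exact (abs_le.1 h).1

theorem le_infBarycenter [BorelSpace E] {f : E → ℝ} {x : E} (hx : x ∈ A) {c : ℝ}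
    (h : ∀ μ : ProbabilityMeasure A, IsBarycenter μ x → c ≤ ∫ y : A, f y ∂(μ : Measure A)) :
    c ≤ infBarycenter A f x := by
  have : Nonempty (measuresWithBarycenter A x) := ⟨_, isBarycenter_dirac hx⟩
  exact le_ciInf fun μ => h μ.1 μ.2

theorem exists_integral_lt_of_infBarycenter_lt [BorelSpace E] {f : E → ℝ} {x : E} (hx : x ∈ A)
    {r : ℝ} (h : infBarycenter A f x < r) :
    ∃ μ : ProbabilityMeasure A, IsBarycenter μ x ∧ ∫ y : A, f y ∂(μ : Measure A) < r := by
  by_contra! hn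
  exact h.not_ge (le_infBarycenter hx hn)

theorem convexOn_infBarycenter [BorelSpace E] (hA : Convex ℝ A) {f : E → ℝ} (hf : ContinuousOn f A)
    {C : ℝ} (hC : ∀ y ∈ A, |f y| ≤ C) : ConvexOn ℝ A (infBarycenter A f) := by
  refine ⟨hA, fun x hx y hy a b ha hb hab => le_of_forall_pos_le_add fun ε hε => ?_⟩
  obtain ⟨μ, hμ, h1⟩ := exists_integral_lt_of_infBarycenter_lt hx (lt_add_of_pos_right _ hε)
  obtain ⟨ν, hν, h2⟩ := exists_integral_lt_of_infBarycenter_lt hy (lt_add_of_pos_right _ hε)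
  obtain ⟨ρ, hρ, hint⟩ := hμ.exists_mixture hν ha hb hab
  refine (infBarycenter_le hC hρ).trans ?_
  rw [hint _ (integrable_of_continuousOn hf hC _) (integrable_of_continuousOn hf hC _)]
  calc _ ≤ a * (infBarycenter A f x + ε) + b * (infBarycenter A f y + ε) := by gcongr
    _ = a • infBarycenter A f x + b • infBarycenter A f y + (a + b) * ε := by
      simp only [smul_eq_mul]; ring
    _ = _ := by rw [hab, one_mul]

/-- The envelope is convex, and Dirac measures show that it is a minorant of `f`. -/
theorem infBarycenter_le_coFun [BorelSpace E] (hA : Convex ℝ A) {f : E → ℝ} (hf : ContinuousOn f A)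
    {C : ℝ} (hC : ∀ y ∈ A, |f y| ≤ C) {x : E} (hx : x ∈ A) : infBarycenter A f x ≤ coFun A f x := by
  refine le_coFun (convexOn_infBarycenter hA hf hC) (fun y hy => ?_) hx
  refine (infBarycenter_le hC (isBarycenter_dirac hy)).trans_eq ?_
  exact integral_dirac' (fun z : A => f z) _
    (continuousOn_iff_continuous_domRestrict.1 hf).stronglyMeasurable

/-- If a convex function `g` on `A` with `g ≤ f` is lower semicontinuous at `x₀`, then `∫ f dμ` is
almost at least `g x₀` for all measures `μ` with barycenter near `x₀`. -/
theorem eventually_lt_integral_of_lowerSemicontinuousWithinAt [IsTopologicalAddGroup E]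
    [ContinuousSMul ℝ E] [LocallyConvexSpace ℝ E] {f g : E → ℝ} (hg : ConvexOn ℝ A g)
    (hgf : ∀ y ∈ A, g y ≤ f y) {x₀ : E}
    (hl : LowerSemicontinuousWithinAt g A x₀) {r : ℝ} (hr : r < g x₀) :
    ∀ᶠ x in 𝓝 x₀, ∀ μ : ProbabilityMeasure A, IsBarycenter μ x →
      Integrable (fun y : A => f y) (μ : Measure A) → r ≤ ∫ y : A, f y ∂(μ : Measure A) := by
  obtain ⟨U, hU, hxU, hUr⟩ := mem_nhdsWithin.1 (hl r hr)
  filter_upwards [hU.mem_nhds hxU] with x hx μ hμ hf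
  by_contra! hlt
  obtain ⟨z, ⟨hz1, hz2⟩, hz⟩ := mem_closure_iff.1 (hμ.mem_closure_convexHull_graph hf)
    (U ×ˢ Set.Iio r) (hU.prod isOpen_Iio) ⟨hx, hlt⟩
  -- The hull of the graph stays in the convex epigraph of `g`, so no integral of `g` is needed.
  have hepi := convexHull_min (s := (fun y => (y, f y)) '' A)
    (t := {p : E × ℝ | p.1 ∈ A ∧ g p.1 ≤ p.2})
    (by rintro _ ⟨y, hy, rfl⟩; exact ⟨hy, hgf y hy⟩) hg.convex_epigraph hz
  exact ((hUr ⟨hz1, hepi.1⟩).trans_le hepi.2).not_gt hz2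

end Barycenter

end MuCompact

open MuCompact in
theorem mainTheorem10 {E : Type*} [AddCommGroup E] [Module ℝ E] [TopologicalSpace E]
    [IsTopologicalAddGroup E] [ContinuousSMul ℝ E] [LocallyConvexSpace ℝ E] [T2Space E]
    [MeasurableSpace E] [BorelSpace E] (A : Set E) (hA : MuCompact.IsAdmissible A)
    (hconv : Convex ℝ A) (hpt : MuCompact.IsPointwiseMuCompact A)
    (hnot : ¬ MuCompact.IsMuCompact A) :
    ∃ f : E → ℝ, ContinuousOn f A ∧ (∃ C : ℝ, ∀ x ∈ A, |f x| ≤ C) ∧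
      ¬ LowerSemicontinuousOn (MuCompact.coFun A f) A ∧
      ¬ ∀ x ∈ A, MuCompact.coClosureFun A f x =
        ⨅ μ : MuCompact.measuresWithBarycenter A x, ∫ y : A, f y ∂(μ.1 : Measure A) := by
  have : PolishSpace A := hA.polishSpace hconv
  let _ := TopologicalSpace.upgradeIsCompletelyMetrizable A
  have hcl : closure (convexHull ℝ A) = A := by
    rw [hconv.convexHull_eq]; exact hA.isClosed.closure_eq
  unfold IsMuCompact at hnot
  push Not at hnot
  rw [hcl] at hnot
  obtain ⟨K, hKA, hK, hS⟩ := hnot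
  have hclosed := isClosed_setOf_isBarycenter hA.isBounded hK
  have htight := fun h => hS (hclosed.closure_eq ▸ isCompact_closure_of_isTightMeasureSet h)
  obtain ⟨ε, hε, η, hη, μ, hμS, hμ⟩ := exists_seq_measure_thickening_le htight
  choose b hbK hb using hμS
  obtain ⟨x₀, hx₀K, hx₀⟩ := hK.exists_mapClusterPt (f := atTop) (u := b)
    (tendsto_principal.2 (Eventually.of_forall hbK))
  have hx₀A := hKA hx₀K
  have hc := hpt x₀ (hcl.symm ▸ hx₀A)
  obtain ⟨T, hT, hTm⟩ := isTightMeasureSet_iff_exists_isCompact_measure_compl_le.1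
    (isTightMeasureSet_of_isCompact_closure hc.closure) (ENNReal.ofReal (ε / 2)) (by simpa)
  let k : A → ℝ := fun y => thickenedIndicator hη T y
  have hkc : Continuous k := NNReal.continuous_coe.comp (thickenedIndicator hη T).continuous
  have hk0 (y : A) : 0 ≤ k y := NNReal.coe_nonneg _
  have hk1 (y : A) : k y ≤ 1 := NNReal.coe_le_one.2 (thickenedIndicator_le_one hη T y)
  have hkT (y : A) (hy : y ∈ T) : k y = 1 := by
    simp only [k, thickenedIndicator_one hη T hy, NNReal.coe_one]
  have hkT' (y : A) (hy : y ∉ Metric.thickening η T) : k y = 0 := by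
    simp only [k, thickenedIndicator_zero hη T hy, NNReal.coe_zero]
  -- The extension by zero need not be continuous on `E`; only values on `A` matter.
  obtain ⟨f, hfk⟩ : ∃ f : E → ℝ, ∀ y : A, f y = k y :=
    ⟨Function.extend (↑) k 0, fun y => Subtype.val_injective.extend_apply k 0 y⟩
  have hf : ContinuousOn f A := continuousOn_iff_continuous_domRestrict.2 (by
    convert hkc using 1; exact funext hfk)
  have hC : ∀ y ∈ A, |f y| ≤ 1 := fun y hy => by
    rw [hfk ⟨y, hy⟩, abs_of_nonneg (hk0 _)]; exact hk1 _
  have hint (ν : ProbabilityMeasure A) := integrable_of_continuousOn hf hC (ν : Measure A)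
  have hlow : 1 - ε / 2 ≤ infBarycenter A f x₀ := le_infBarycenter hx₀A fun ν hν => by
    have h1 : (ν : Measure A).real Tᶜ ≤ ε / 2 :=
      ENNReal.toReal_le_of_le_ofReal (by positivity) (hTm _ ⟨ν, hν, rfl⟩)
    rw [probReal_compl_eq_one_sub hT.measurableSet] at h1
    have h2 : ∫ y : A, T.indicator 1 y ∂(ν : Measure A) ≤ ∫ y : A, f y ∂(ν : Measure A) := by
      refine integral_mono ((integrable_const 1).indicator hT.measurableSet) (hint ν) fun y => ?_
      rw [hfk]
      refine Set.indicator_le' (fun y hy => ?_) (fun y _ => hk0 y) y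
      exact (hkT y hy).ge
    rw [integral_indicator_one hT.measurableSet] at h2
    linarith
  have hup : ∀ᶠ n in atTop, ∫ y : A, f y ∂(μ n : Measure A) ≤ 1 - ε := by
    filter_upwards [hμ T hT] with n hn
    have hm := (Metric.isOpen_thickening (δ := η) (E := T)).measurableSet
    refine le_trans ?_ ((integral_indicator_one (μ := (μ n : Measure A)) hm).trans_le hn)
    refine integral_mono (hint _) ((integrable_const 1).indicator hm) fun y => ?_
    rw [hfk]
    by_cases hy : y ∈ Metric.thickening η T
    · simpa [hy] using hk1 y
    · rw [hkT' y hy]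
      exact Set.indicator_nonneg (fun _ _ => zero_le_one) y
  have hfc : ∀ y ∈ A, -1 ≤ f y := fun y hy => (abs_le.1 (hC y hy)).1
  refine ⟨f, hf, ⟨1, hC⟩, fun hl => ?_, fun hrep => ?_⟩
  · have h := eventually_lt_integral_of_lowerSemicontinuousWithinAt
      (convexOn_coFun hconv hfc) (fun y hy => coFun_le hconv hfc hy) (hl x₀ hx₀A)
      -- Any level strictly between `1 - ε` and `1 - ε / 2` works.
      (r := 1 - 3 * ε / 4)
      (by linarith [infBarycenter_le_coFun hconv hf hC hx₀A])
    obtain ⟨n, hn, hn'⟩ := ((hx₀.frequently h).and_eventually hup).exists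
    linarith [hn (μ n) (hb n) (hint _)]
  · have hl := lowerSemicontinuousOn_coClosureFun hconv hfc
    have h := eventually_lt_integral_of_lowerSemicontinuousWithinAt
      (convexOn_coClosureFun hconv hfc) (fun y hy => coClosureFun_le hconv hfc hy) (hl x₀ hx₀A)
      (r := 1 - 3 * ε / 4)
      (by rw [hrep x₀ hx₀A]; change _ < infBarycenter A f x₀; linarith)
    obtain ⟨n, hn, hn'⟩ := ((hx₀.frequently h).and_eventually hup).exists
    linarith [hn (μ n) (hb n) (hint _)]
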